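/- Let $X$ be a compact topological space with a non-negative measure $\mu$ defined on a $\sigma$-algebra containing the Borel sets. Let $(\mathcal N,\mathcal A)$ be a finite directed graph, $\mathcal A\subset\mathcal N\times\mathcal N$, with supplies $s_i\in\mathbb R$ ($i\in\mathcal N$), a set of stations $\mathcal S\subset\mathcal N$, flow limits $a_{ij},b_{ij}\in\mathbb R$ for $(i,j)\in\mathcal A$, an assignment cost $c:X\times\mathcal S\to\mathbb R\cup\{+\infty\}$ and arc costs $c_{ij}:\mathbb R\to\mathbb R\cup\{+\infty\}$. For $p\in\mathbb R^{|\mathcal A|}$ put $(\operatorname{div}p)_i=\sum_{(i,j)\in\mathcal A}p_{ij}-\sum_{(j,i)\in\mathcal A}p_{ji}$. Assume that (a) $c$ is lower semicontinuous and bounded from below; (b) each $c_{ij}$ is convex and lower semicontinuous; (c) there are a measurable map $T:X\to\mathcal S$ and $p\in\mathbb R^{|\mathcal A|}$ with $(\operatorname{div}p)_i=s_i-\mu(T^{-1}(i))$ for $i\in\mathcal S$, $(\operatorname{div}p)_i=s_i$ for $i\in\mathcal N\setminus\mathcal S$, and $a_{ij}\le p_{ij}\le b_{ij}$ for $(i,j)\in\mathcal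 A$. Consider the Kantorovich problem $$\text{(KP)}\qquad \inf_{\pi,\,p}\ \int_{X\times\mathcal S}c\,\mathrm d\pi+\sum_{(i,j)\in\mathcal A}c_{ij}(p_{ij})$$ over the non-negative measures $\pi$ on $X\times\mathcal S$ and the $p\in\mathbb R^{|\mathcal A|}$ such that $(\operatorname{div}p)_i=s_i-\pi(X\times\{i\})$ for $i\in\mathcal S$, $(\operatorname{div}p)_i=s_i$ for $i\in\mathcal N\setminus\mathcal S$, $\sum_{i\in\mathcal S}\pi(A\times\{i\})=\mu(A)$ for every measurable $A\subset X$, and $a_{ij}\le p_{ij}\le b_{ij}$ for $(i,j)\in\mathcal A$. For $\psi\in\mathbb R^{|\mathcal N|}$ let $$q(\psi)=\int_X\min_{i\in\mathcal S}\{c(x,i)-\psi_i\}\,\mathrm d\mu(x)+\sum_{i\in\mathcal N}\psi_is_i+\sum_{(i,j)\in\mathcal A}\min_{p\in[a_{ij},b_{ij}]}\{c_{ij}(p)-(\psi_i-\psi_j)p\}.$$ Then the minima over $[a_{ij},b_{ij}]$ are attained, $q$ is a concave function with values in $\mathbb R\cup\{+\infty\}$, with values in $\mathbb R$ if the value of (KP)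 is not $+\infty$, and $$\text{value of (KP)}=\sup_{\psi\in\mathbb R^{|\mathcal N|}}q(\psi)\quad\text{in }\mathbb R\cup\{+\infty\}.$$ Moreover, the infimum in (KP) is attained at some $(\pi^*,p^*)$. -/

import Mathlib

open MeasureTheory Set
open scoped ENNReal

noncomputable section

/-- The integral of an extended-real-valued function, `∫ f⁺ dμ - ∫ f⁻ dμ` (it has its usual
meaning as soon as one of the two parts is finite, e.g. `f` bounded below and `μ` finite). -/
def extIntegral {Y : Type*} [MeasurableSpace Y] (μ : Measure Y) (f : Y → EReal) : EReal :=
  ((∫⁻ y, (f y).toENNReal ∂μ : ℝ≥0∞) : EReal) - ((∫⁻ y, (-f y).toENNReal ∂μ : ℝ≥0∞) : EReal)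

/-- Convexity of a function `ℝ → ℝ ∪ {+∞}`. -/
def ExtConvex (f : ℝ → EReal) : Prop :=
  ∀ x y t : ℝ, 0 ≤ t → t ≤ 1 →
    f (t * x + (1 - t) * y) ≤ (t : EReal) * f x + ((1 - t : ℝ) : EReal) * f y

/-- Data of a combined spatial assignment and network flow problem: demand measure on `X`, directed
graph with node set `N` and arc set `arcs`, endpoint stations, supplies, costs and arc limits. -/
structure AssignmentFlow (X N : Type*) [MeasurableSpace X] where
  /-- the demand distribution -/
  μ : Measure X
  /-- the arcs `(i, j)` of the directed graph -/
  arcs : Finset (N × N)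
  /-- the endpoint stations -/
  stations : Finset N
  /-- the net supply of each node -/
  supply : N → ℝ
  /-- the assignment cost `c(x, i)` -/
  cost : X × stations → EReal
  /-- the arc cost functions -/
  arcCost : arcs → ℝ → EReal
  /-- the lower flow limits -/
  lo : arcs → ℝ
  /-- the upper flow limits -/
  hi : arcs → ℝ

namespace AssignmentFlow

variable {X N : Type*} [MeasurableSpace X] [DecidableEq N] (P : AssignmentFlow X N)

/-- Flow leaving the node `i` minus flow entering it. -/
def netOutflow (p : P.arcs → ℝ) (i : N) : ℝ :=
  (∑ e : P.arcs, if e.1.1 = i then p e else 0) - ∑ e : P.arcs, if e.1.2 = i then p e else 0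

/-- The flow conservation and arc limit constraints, when the station `i` serves the amount
`load i` of demand. (The supplies and flows are finite, so the constraint forces `load i < ∞`.) -/
structure FlowFeasible (load : P.stations → ℝ≥0∞) (p : P.arcs → ℝ) : Prop where
  station : ∀ i : P.stations,
    (P.netOutflow p i : EReal) = (P.supply i : EReal) - (load i : EReal)
  other : ∀ i : N, i ∉ P.stations → P.netOutflow p i = P.supply i
  limits : ∀ e : P.arcs, P.lo e ≤ p e ∧ p e ≤ P.hi e

variable [MeasurableSpace N]

/-- Feasibility of an assignment map `T` and a flow `p` for the original (Monge) problem. -/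
def MongeFeasible (T : X → P.stations) (p : P.arcs → ℝ) : Prop :=
  Measurable T ∧ P.FlowFeasible (fun i => P.μ.map T {i}) p

/-- Feasibility of a transport plan `π` and a flow `p` for the Kantorovich relaxation. -/
def KantorovichFeasible (π : Measure (X × P.stations)) (p : P.arcs → ℝ) : Prop :=
  (∀ A : Set X, MeasurableSet A → ∑ i : P.stations, π (A ×ˢ {i}) = P.μ A) ∧
    P.FlowFeasible (fun i => π (univ ×ˢ {i})) p

/-- The objective of the Kantorovich relaxation. -/
def kantorovichCost (π : Measure (X × P.stations)) (p : P.arcs → ℝ) : EReal :=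
  extIntegral π P.cost + ∑ e : P.arcs, P.arcCost e (p e)

/-- The optimal value of the Kantorovich relaxation. -/
def kantorovichValue : EReal :=
  ⨅ (π : Measure (X × P.stations)) (p : P.arcs → ℝ) (_ : P.KantorovichFeasible π p),
    P.kantorovichCost π p

/-- The reduced cost `c_e(t) - (ψ_i - ψ_j) t` of the flow `t` on the arc `e = (i, j)`. -/
def reducedArcCost (ψ : N → ℝ) (e : P.arcs) (t : ℝ) : EReal :=
  P.arcCost e t - (((ψ e.1.1 - ψ e.1.2) * t : ℝ) : EReal)

/-- The dual function. -/
def dual [Fintype N] (ψ : N → ℝ) : EReal :=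
  extIntegral P.μ (fun x => ⨅ i : P.stations, (P.cost (x, i) - (ψ i : EReal)))
    + ((∑ i : N, ψ i * P.supply i : ℝ) : EReal)
    + ∑ e : P.arcs, ⨅ t ∈ Icc (P.lo e) (P.hi e), P.reducedArcCost ψ e t

end AssignmentFlow

end

/-! There are finitely many stations, so a plan `π` with first marginal `μ` amounts to a splitting
of `μ` into measures `ρ i`, the slices of `π`. Finiteness of `μ` follows from the feasible Monge
pair: every station load is finite and the loads add up to `μ univ`.

Splittings form a compact space under setwise convergence (`range_eval`), and integrals of
nonnegative functions are lower semicontinuous there (`lowerSemicontinuous_lintegral`). Of `c` this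
needs only measurability and a lower bound. As the arc limits are compact too, the total cost has a
minimizer among the feasible pairs (`exists_isMin_totalCost`).

For duality the supplies are perturbed. `dual ψ` is the minimum over `(ρ, p)` of the Lagrangian that
prices violations of the balance equations by `ψ` (`dual_le`, `exists_dual_eq`); weak duality and
concavity follow, the Lagrangian being affine in `ψ`. For the reverse inequality, `valueEpigraph` is
convex, and closed as a projection along a compact factor. If the real `α` is below the optimal
value, Hahn–Banach separates `(supply, α)` from it, and the normal yields a `ψ` with `α ≤ dual ψ`
(`exists_le_dual`). A vertical hyperplane is handled by a large multiple of its normal, because the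
epigraph is bounded below. -/

open Filter Topology
open scoped NNReal

/-! ### Integrals of extended-real functions bounded below -/

section ExtIntegral

variable {Y Z : Type*} [MeasurableSpace Y] [MeasurableSpace Z]

/-- This is `a = a⁺ - a⁻` shifted by `k`, written without subtraction so that it can be integrated
in `ℝ≥0∞`. -/
theorem EReal.toENNReal_add_add_toENNReal_neg {a : EReal} {k : ℝ≥0} (h : -(k : ℝ) ≤ a) :
    (a + ((k : ℝ) : EReal)).toENNReal + (-a).toENNReal = a.toENNReal + k := by
  induction a with
  | bot => exact absurd h (by simp [← EReal.coe_neg])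
  | top => simp
  | coe a =>
    have h' : -(k : ℝ) ≤ a := by exact_mod_cast h
    rw [← EReal.coe_add, ← EReal.coe_neg, EReal.real_coe_toENNReal, EReal.real_coe_toENNReal,
      EReal.real_coe_toENNReal, ← ENNReal.ofReal_coe_nnreal]
    rcases le_total 0 a with ha | ha
    · rw [ENNReal.ofReal_of_nonpos (neg_nonpos.2 ha), add_zero,
        ENNReal.ofReal_add ha k.coe_nonneg]
    · rw [ENNReal.ofReal_of_nonpos ha, zero_add, ← ENNReal.ofReal_add (by linarith) (by linarith)]
      congr 1
      ring

theorem EReal.coe_ennreal_sub_eq_of_add_eq {A B C : ℝ≥0∞} {r : ℝ≥0} (hC : C ≠ ⊤)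
    (h : B + C = A + r) : (A : EReal) - C = (B : EReal) - ((r : ℝ) : EReal) := by
  lift C to ℝ≥0 using hC
  induction A with
  | top =>
    have : B = ⊤ := by simpa using h
    subst this
    rw [EReal.coe_ennreal_top, EReal.coe_nnreal_eq_coe_real, EReal.top_sub_coe, EReal.top_sub_coe]
  | coe A =>
    have hB : B ≠ ⊤ := by
      rintro rfl
      have : (⊤ : ℝ≥0∞) = A + r := by simpa using h
      exact ENNReal.add_ne_top.2 ⟨ENNReal.coe_ne_top, ENNReal.coe_ne_top⟩ this.symm
    lift B to ℝ≥0 using hB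
    have h' : (B : ℝ) + C = A + r := by exact_mod_cast h
    simp only [EReal.coe_nnreal_eq_coe_real]
    rw [← EReal.coe_sub, ← EReal.coe_sub]
    congr 1
    linarith

theorem measurable_ereal_add_coe {f : Y → EReal} (hf : Measurable f) (r : ℝ) :
    Measurable fun y => f y + (r : EReal) := by
  have : Continuous fun a : EReal => a + (r : EReal) := by
    refine continuous_iff_continuousAt.2 fun a => ?_
    have := EReal.continuousAt_add (p := (a, (r : EReal))) (by simp) (by simp)
    exact ContinuousAt.comp (f := fun a : EReal => (a, (r : EReal))) this (by fun_prop)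
  exact this.measurable.comp hf

/-- Reduces additivity and semicontinuity to one Lebesgue integral of a nonnegative function,
corrected by a finite constant. -/
theorem extIntegral_eq_lintegral_sub {μ : Measure Y} [IsFiniteMeasure μ] {f : Y → EReal}
    (hf : Measurable f) {k : ℝ≥0} (hk : ∀ y, -(k : ℝ) ≤ f y) :
    extIntegral μ f = ((∫⁻ y, (f y + ((k : ℝ) : EReal)).toENNReal ∂μ : ℝ≥0∞) : EReal)
      - ((k * μ.real univ : ℝ) : EReal) := by
  have hm : Measurable fun y => (f y + ((k : ℝ) : EReal)).toENNReal :=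
    (measurable_ereal_add_coe hf _).ereal_toENNReal
  have hneg : ∫⁻ y, (-f y).toENNReal ∂μ ≤ k * μ univ := by
    rw [← lintegral_const]
    refine lintegral_mono fun y => ?_
    have : -f y ≤ ((k : ℝ) : EReal) := by
      rw [EReal.neg_le]; exact_mod_cast hk y
    simpa using EReal.toENNReal_le_toENNReal this
  have hne : ∫⁻ y, (-f y).toENNReal ∂μ ≠ ⊤ :=
    ne_top_of_le_ne_top (ENNReal.mul_ne_top ENNReal.coe_ne_top (measure_ne_top _ _)) hneg
  have key : ∫⁻ y, (f y + ((k : ℝ) : EReal)).toENNReal ∂μ + ∫⁻ y, (-f y).toENNReal ∂μ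
      = ∫⁻ y, (f y).toENNReal ∂μ + ((k * (μ univ).toNNReal : ℝ≥0) : ℝ≥0∞) := by
    rw [← lintegral_add_left hm]
    simp_rw [EReal.toENNReal_add_add_toENNReal_neg (hk _)]
    rw [lintegral_add_left hf.ereal_toENNReal, lintegral_const, ENNReal.coe_mul,
      ENNReal.coe_toNNReal (measure_ne_top _ _)]
  have := EReal.coe_ennreal_sub_eq_of_add_eq hne key
  rw [extIntegral, this]
  rfl

theorem extIntegral_ne_bot {μ : Measure Y} [IsFiniteMeasure μ] {f : Y → EReal}
    (hf : Measurable f) {k : ℝ≥0} (hk : ∀ y, -(k : ℝ) ≤ f y) : extIntegral μ f ≠ ⊥ := by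
  rw [extIntegral_eq_lintegral_sub hf hk, sub_eq_add_neg, ← EReal.coe_neg]
  exact fun h => (EReal.add_eq_bot_iff.1 h).elim (by simp) (EReal.coe_ne_bot _)

theorem extIntegral_mono {μ : Measure Y} {f g : Y → EReal} (h : ∀ y, f y ≤ g y) :
    extIntegral μ f ≤ extIntegral μ g := by
  refine EReal.sub_le_sub ?_ ?_
  · exact EReal.coe_ennreal_le_coe_ennreal_iff.2
      (lintegral_mono fun y => EReal.toENNReal_le_toENNReal (h y))
  · exact EReal.coe_ennreal_le_coe_ennreal_iff.2
      (lintegral_mono fun y => EReal.toENNReal_le_toENNReal (EReal.neg_le_neg_iff.2 (h y)))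

theorem extIntegral_congr_ae {μ : Measure Y} {f g : Y → EReal} (h : f =ᵐ[μ] g) :
    extIntegral μ f = extIntegral μ g := by
  rw [extIntegral, extIntegral, lintegral_congr_ae (h.mono fun y hy => by rw [hy]),
    lintegral_congr_ae (f := fun y => (-f y).toENNReal) (g := fun y => (-g y).toENNReal)
      (h.mono fun y hy => by simp only [hy])]

theorem extIntegral_map {μ : Measure Y} {e : Y → Z} (he : Measurable e) {f : Z → EReal}
    (hf : Measurable f) : extIntegral (μ.map e) f = extIntegral μ (f ∘ e) := by
  rw [extIntegral, extIntegral, lintegral_map hf.ereal_toENNReal he,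
    lintegral_map (f := fun y => (-f y).toENNReal) hf.neg.ereal_toENNReal he]
  rfl

theorem extIntegral_sub_coe {μ : Measure Y} [IsFiniteMeasure μ] {f : Y → EReal}
    (hf : Measurable f) {k : ℝ≥0} (hk : ∀ y, -(k : ℝ) ≤ f y) (r : ℝ) :
    extIntegral μ (fun y => f y - (r : EReal)) =
      extIntegral μ f - ((r * μ.real univ : ℝ) : EReal) := by
  -- With this `l`, both `l` and `l' = l + r` are nonnegative, and `f + l` equals `(f - r) + l'`.
  obtain ⟨l, hl⟩ : ∃ l : ℝ≥0, (l : ℝ) = k + |r| := ⟨k + ‖r‖₊, by simp⟩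
  have hlk : ∀ y, -(l : ℝ) ≤ f y := fun y => by
    refine le_trans ?_ (hk y)
    have := abs_nonneg r
    exact_mod_cast (by rw [hl]; linarith : -(l : ℝ) ≤ -k)
  obtain ⟨l', hl'⟩ : ∃ l' : ℝ≥0, (l' : ℝ) = l + r :=
    ⟨⟨l + r, by rw [hl]; linarith [neg_abs_le r, k.2]⟩, rfl⟩
  have hshift : ∀ y, f y - (r : EReal) + ((l' : ℝ) : EReal) = f y + ((l : ℝ) : EReal) := fun y => by
    rw [hl', sub_eq_add_neg, add_assoc, ← EReal.coe_neg, ← EReal.coe_add]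
    congr 2
    ring
  have hlk' : ∀ y, -(l' : ℝ) ≤ f y - (r : EReal) := fun y => by
    have h1 := add_le_add_left (hlk y) ((-r : ℝ) : EReal)
    rw [sub_eq_add_neg, ← EReal.coe_neg]
    refine le_trans (le_of_eq ?_) h1
    rw [hl', ← EReal.coe_neg, ← EReal.coe_add]
    congr 1
    ring
  have hfm : Measurable fun y => f y - (r : EReal) := by
    simpa [sub_eq_add_neg, ← EReal.coe_neg] using measurable_ereal_add_coe hf (-r)
  rw [extIntegral_eq_lintegral_sub hf hlk, extIntegral_eq_lintegral_sub hfm hlk']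
  simp_rw [hshift]
  rw [sub_eq_add_neg, sub_eq_add_neg, sub_eq_add_neg, add_assoc, ← EReal.coe_neg, ← EReal.coe_neg,
    ← EReal.coe_neg, ← EReal.coe_add, hl']
  congr 2
  ring

theorem EReal.sum_sub_coe {ι : Type*} (s : Finset ι) (a : ι → EReal) (r : ι → ℝ) :
    ∑ i ∈ s, (a i - (r i : EReal)) = ∑ i ∈ s, a i - ((∑ i ∈ s, r i : ℝ) : EReal) := by
  simp_rw [sub_eq_add_neg]
  rw [Finset.sum_add_distrib, ← EReal.coe_neg, ← Finset.sum_neg_distrib]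
  congr 1
  induction s using Finset.cons_induction with
  | empty => simp
  | cons i s hi ih => rw [Finset.sum_cons, Finset.sum_cons, ih, EReal.coe_add, EReal.coe_neg]

theorem EReal.coe_ennreal_sum {ι : Type*} (s : Finset ι) (a : ι → ℝ≥0∞) :
    ((∑ i ∈ s, a i : ℝ≥0∞) : EReal) = ∑ i ∈ s, (a i : EReal) := by
  induction s using Finset.cons_induction with
  | empty => simp
  | cons i s hi ih => simp [Finset.sum_cons, ih]

theorem extIntegral_sum_measure {ι : Type*} [Fintype ι] {μ : ι → Measure Y}
    [∀ i, IsFiniteMeasure (μ i)] {f : Y → EReal}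
    (hf : Measurable f) {k : ℝ≥0} (hk : ∀ y, -(k : ℝ) ≤ f y) :
    extIntegral (∑ i, μ i) f = ∑ i, extIntegral (μ i) f := by
  rw [extIntegral_eq_lintegral_sub hf hk]
  simp_rw [extIntegral_eq_lintegral_sub hf hk]
  rw [EReal.sum_sub_coe, lintegral_finsetSum_measure, EReal.coe_ennreal_sum, ← Finset.mul_sum]
  congr 3
  rw [Measure.real, Measure.finsetSum_apply, ENNReal.toReal_sum fun i _ => measure_ne_top _ _]
  rfl

end ExtIntegral

/-! ### Compactness of the splittings of a finite measure; measurable selection -/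

section Splitting

variable {X : Type*} [MeasurableSpace X]

/-- Domination by a finite measure upgrades finite to countable additivity: the tail of a disjoint
union has small `μ`-mass, hence small `m`-mass. -/
theorem exists_measure_eq_of_additive_of_le (μ : Measure X) [IsFiniteMeasure μ]
    (m : {A : Set X // MeasurableSet A} → ℝ≥0∞) (hle : ∀ A, m A ≤ μ A)
    (hadd : ∀ A B : {A : Set X // MeasurableSet A}, Disjoint A.1 B.1 →
      m ⟨A.1 ∪ B.1, A.2.union B.2⟩ = m A + m B) :
    ∃ ρ : Measure X, ∀ A, m A = ρ A.1 := by
  have h0 : m ⟨∅, MeasurableSet.empty⟩ = 0 := le_antisymm (by simpa using hle ⟨∅, .empty⟩) bot_le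
  have hU : ∀ ⦃f : ℕ → Set X⦄ (hf : ∀ i, MeasurableSet (f i)), Pairwise (Function.onFun Disjoint f) →
      m ⟨⋃ i, f i, MeasurableSet.iUnion hf⟩ = ∑' i, m ⟨f i, hf i⟩ := by
    intro f hf hd
    have hfn : ∀ n, MeasurableSet (⋃ k, f (k + n)) := fun n => .iUnion fun k => hf _
    have hdn : ∀ n, Pairwise (Function.onFun Disjoint fun k => f (k + n)) := fun n i j hij =>
      hd (by simpa using hij)
    have hstep : ∀ n, m ⟨⋃ k, f (k + n), hfn n⟩
        = m ⟨f n, hf n⟩ + m ⟨⋃ k, f (k + (n + 1)), hfn (n + 1)⟩ := by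
      intro n
      rw [← hadd]
      · congr 2
        ext x
        simp only [mem_iUnion, mem_union]
        constructor
        · rintro ⟨k, hk⟩
          cases k with
          | zero => left; simpa using hk
          | succ k => right; exact ⟨k, by rwa [← add_assoc, add_right_comm]⟩
        · rintro (h | ⟨k, hk⟩)
          · exact ⟨0, by simpa using h⟩
          · exact ⟨k + 1, by rwa [add_right_comm]⟩
      · refine disjoint_iUnion_right.2 fun k => hd (by omega)
    have hpart : ∀ n, ∑ i ∈ Finset.range n, m ⟨f i, hf i⟩ + m ⟨⋃ k, f (k + n), hfn n⟩
        = m ⟨⋃ i, f i, MeasurableSet.iUnion hf⟩ := by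
      intro n
      induction n with
      | zero => simp
      | succ n ih => rw [← ih, hstep n, Finset.sum_range_succ, add_assoc]
    have htail : Tendsto (fun n => m ⟨⋃ k, f (k + n), hfn n⟩) atTop (𝓝 0) := by
      refine tendsto_of_tendsto_of_tendsto_of_le_of_le tendsto_const_nhds ?_
        (fun _ => bot_le) (fun n => hle _)
      have hsum : ∀ n, μ (⋃ k, f (k + n)) = ∑' k, μ (f (k + n)) := fun n =>
        measure_iUnion (hdn n) fun k => hf _
      simp_rw [hsum]
      refine ENNReal.tendsto_sum_nat_add (fun i => μ (f i)) ?_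
      rw [← measure_iUnion hd hf]
      exact measure_ne_top _ _
    have hlim := (ENNReal.tendsto_nat_tsum fun i => m ⟨f i, hf i⟩).add htail
    simp_rw [hpart, add_zero] at hlim
    exact tendsto_nhds_unique tendsto_const_nhds hlim
  exact ⟨Measure.ofMeasurable (fun A hA => m ⟨A, hA⟩) h0 hU,
    fun A => (Measure.ofMeasurable_apply (m := fun A hA => m ⟨A, hA⟩) A.1 A.2).symm⟩

/-- The ways of writing the measure `μ` as a sum of measures indexed by `ι`. -/
structure MeasureSplitting (ι : Type*) [Fintype ι] (μ : Measure X) where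
  /-- the parts of the splitting -/
  part : ι → Measure X
  sum_part : ∑ i, part i = μ

namespace MeasureSplitting

variable {ι : Type*} [Fintype ι] {μ : Measure X}

/-- The values of the parts of a splitting on measurable sets. -/
def eval (ρ : MeasureSplitting ι μ) (i : ι) (A : {A : Set X // MeasurableSet A}) : ℝ≥0∞ :=
  ρ.1 i A.1

/-- The topology of setwise convergence. -/
instance : TopologicalSpace (MeasureSplitting ι μ) :=
  TopologicalSpace.induced eval inferInstance

theorem isInducing_eval : IsInducing (eval : MeasureSplitting ι μ → _) := ⟨rfl⟩

theorem continuous_apply_measure (i : ι) {A : Set X} (hA : MeasurableSet A) :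
    Continuous fun ρ : MeasureSplitting ι μ => ρ.1 i A :=
  ((continuous_apply (⟨A, hA⟩ : {A : Set X // MeasurableSet A})).comp
    (continuous_apply i)).comp isInducing_eval.continuous

theorem sum_apply (ρ : MeasureSplitting ι μ) (A : Set X) : ∑ i, ρ.1 i A = μ A := by
  rw [← Measure.finsetSum_apply, ρ.2]

theorem apply_le (ρ : MeasureSplitting ι μ) (i : ι) (A : Set X) : ρ.1 i A ≤ μ A := by
  rw [← ρ.sum_apply A]
  exact Finset.single_le_sum (f := fun i => ρ.1 i A) (fun _ _ => bot_le) (Finset.mem_univ i)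

instance [IsFiniteMeasure μ] (ρ : MeasureSplitting ι μ) (i : ι) : IsFiniteMeasure (ρ.1 i) :=
  ⟨(ρ.apply_le i univ).trans_lt (measure_lt_top _ _)⟩

/-- Only equations between finitely many coordinates remain, so the range is closed in a product of
copies of `ℝ≥0∞`, and Tychonoff gives compactness. Domination by `μ` comes from the sum condition.
-/
theorem range_eval [IsFiniteMeasure μ] : range (eval : MeasureSplitting ι μ → _) =
    {m | (∀ i, ∀ A B : {A : Set X // MeasurableSet A}, Disjoint A.1 B.1 →
      m i ⟨A.1 ∪ B.1, A.2.union B.2⟩ = m i A + m i B) ∧ ∀ A, ∑ i, m i A = μ A.1} := by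
  ext m
  constructor
  · rintro ⟨ρ, rfl⟩
    exact ⟨fun i A B h => measure_union h B.2, fun A => ρ.sum_apply A⟩
  · rintro ⟨hadd, hsum⟩
    have hle : ∀ i A, m i A ≤ μ A.1 := fun i A => by
      rw [← hsum A]
      exact Finset.single_le_sum (f := fun i => m i A) (fun _ _ => bot_le) (Finset.mem_univ i)
    choose ρ hρ using fun i => exists_measure_eq_of_additive_of_le μ (m i) (hle i) (hadd i)
    refine ⟨⟨ρ, ?_⟩, ?_⟩
    · ext A hA
      rw [Measure.finsetSum_apply, ← hsum ⟨A, hA⟩]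
      simp [hρ]
    · ext i A
      exact (hρ i A).symm

instance [IsFiniteMeasure μ] : CompactSpace (MeasureSplitting ι μ) := by
  refine ⟨isInducing_eval.isCompact_iff.2 (IsClosed.isCompact ?_)⟩
  rw [image_univ, range_eval, ofPred_and]
  refine IsClosed.inter ?_ ?_
  · simp_rw [ofPred_forall]
    exact isClosed_iInter fun i => isClosed_iInter fun A => isClosed_iInter fun B =>
      isClosed_iInter fun _ => isClosed_eq (by fun_prop) (by fun_prop)
  · simp_rw [ofPred_forall]
    exact isClosed_iInter fun A => isClosed_eq (by fun_prop) (by fun_prop)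

/-- The integral is a supremum over simple functions with finite values, whose integrals are
continuous under setwise convergence. -/
theorem lowerSemicontinuous_lintegral (i : ι) (f : X → ℝ≥0∞) :
    LowerSemicontinuous fun ρ : MeasureSplitting ι μ => ∫⁻ x, f x ∂(ρ.1 i) := by
  simp_rw [lintegral_eq_nnreal, SimpleFunc.map_lintegral]
  refine lowerSemicontinuous_iSup fun φ => lowerSemicontinuous_iSup fun _ =>
    Continuous.lowerSemicontinuous ?_
  refine continuous_finsetSum _ fun y _ => ?_
  exact (ENNReal.continuous_const_mul ENNReal.coe_ne_top).comp
    (continuous_apply_measure i (φ.measurableSet_fiber y))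

theorem continuous_real_apply [IsFiniteMeasure μ] (i : ι) {A : Set X} (hA : MeasurableSet A) :
    Continuous fun ρ : MeasureSplitting ι μ => (ρ.1 i).real A :=
  ENNReal.continuousOn_toReal.comp_continuous (continuous_apply_measure i hA)
    fun _ => measure_ne_top _ _

/-- The convex combination of two splittings. -/
noncomputable def combo (ρ σ : MeasureSplitting ι μ) (a b : ℝ≥0) (hab : a + b = 1) :
    MeasureSplitting ι μ :=
  ⟨fun i => a • ρ.1 i + b • σ.1 i, by
    rw [Finset.sum_add_distrib, ← Finset.smul_sum, ← Finset.smul_sum, ρ.2, σ.2, ← add_smul, hab,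
      one_smul]⟩

/-- The splitting of `μ` along the fibers of a map. -/
noncomputable def ofMap {T : X → ι} (hT : ∀ i, MeasurableSet (T ⁻¹' {i})) :
    MeasureSplitting ι μ :=
  ⟨fun i => μ.restrict (T ⁻¹' {i}), by
    rw [← Measure.sum_fintype, ← Measure.restrict_iUnion (fun i j hij => ?_) hT]
    · rw [← preimage_iUnion, iUnion_of_singleton, preimage_univ, Measure.restrict_univ]
    · exact Disjoint.preimage _ (by simpa using hij)⟩

end MeasureSplitting

theorem exists_measurable_isMin {ι : Type*} [Finite ι] [MeasurableSpace ι]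
    (f : ι → X → EReal) (hf : ∀ i, Measurable (f i)) (hne : X → ι) :
    ∃ T : X → ι, Measurable T ∧ ∀ x i, f (T x) x ≤ f i x := by
  classical
  cases nonempty_fintype ι
  rcases isEmpty_or_nonempty X with hX | ⟨⟨x₀⟩⟩
  · exact ⟨hne, measurable_of_empty _, fun x => hX.elim x⟩
  -- Measurability of the selected value is carried along: it makes the comparison set of the next
  -- step measurable.
  suffices h : ∀ s : Finset ι, ∃ T : X → ι, Measurable T ∧
      (Measurable fun x => f (T x) x) ∧ ∀ x, ∀ i ∈ s, f (T x) x ≤ f i x by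
    obtain ⟨T, hT, -, h⟩ := h Finset.univ
    exact ⟨T, hT, fun x i => h x i (Finset.mem_univ i)⟩
  intro s
  induction s using Finset.cons_induction with
  | empty => exact ⟨fun _ => hne x₀, measurable_const, hf _, by simp⟩
  | cons i s hi ih =>
    obtain ⟨T, hT, hfT, hmin⟩ := ih
    have hset : MeasurableSet {x | f i x ≤ f (T x) x} := measurableSet_le (hf i) hfT
    refine ⟨fun x => if f i x ≤ f (T x) x then i else T x, .ite hset measurable_const hT, ?_, ?_⟩
    · convert (hf i).min hfT using 1
      ext x
      by_cases hx : f i x ≤ f (T x) x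
      · simp [hx]
      · simp [hx, (not_le.1 hx).le]
    · intro x j hj
      rcases Finset.mem_cons.1 hj with rfl | hj
      · by_cases hx : f j x ≤ f (T x) x
        · simp [hx]
        · simpa [hx] using (not_le.1 hx).le
      · by_cases hx : f i x ≤ f (T x) x
        · simpa [hx] using hx.trans (hmin x j hj)
        · simpa [hx] using hmin x j hj

end Splitting

/-! ### Sums and semicontinuity in `EReal` -/

section ERealLemmas

theorem EReal.sum_ne_bot {ι : Type*} (s : Finset ι) {a : ι → EReal} (h : ∀ i, a i ≠ ⊥) :
    ∑ i ∈ s, a i ≠ ⊥ := by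
  induction s using Finset.cons_induction with
  | empty => simp
  | cons i s hi ih =>
    rw [Finset.sum_cons]
    exact fun hb => (EReal.add_eq_bot_iff.1 hb).elim (h i) ih

theorem EReal.coe_mul_sum {ι : Type*} (s : Finset ι) (f : ι → EReal) {a : ℝ} (ha : 0 ≤ a) :
    (a : EReal) * ∑ i ∈ s, f i = ∑ i ∈ s, (a : EReal) * f i := by
  induction s using Finset.cons_induction with
  | empty => simp
  | cons i s hi ih =>
    rw [Finset.sum_cons, Finset.sum_cons, ← ih,
      EReal.left_distrib_of_nonneg_of_ne_top (by exact_mod_cast ha) (EReal.coe_ne_top _)]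

theorem LowerSemicontinuous.ereal_add {Z : Type*} [TopologicalSpace Z] {f g : Z → EReal}
    (hf : LowerSemicontinuous f) (hg : LowerSemicontinuous g) (hf' : ∀ z, f z ≠ ⊥)
    (hg' : ∀ z, g z ≠ ⊥) : LowerSemicontinuous fun z => f z + g z :=
  hf.add' hg fun z => EReal.continuousAt_add (.inr (hg' z)) (.inl (hf' z))

theorem LowerSemicontinuous.ereal_sum {Z ι : Type*} [TopologicalSpace Z] (s : Finset ι)
    {f : ι → Z → EReal} (hf : ∀ i, LowerSemicontinuous (f i)) (hf' : ∀ i z, f i z ≠ ⊥) :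
    LowerSemicontinuous fun z => ∑ i ∈ s, f i z := by
  induction s using Finset.cons_induction with
  | empty => simpa using lowerSemicontinuous_const
  | cons i s hi ih =>
    simp_rw [Finset.sum_cons]
    exact (hf i).ereal_add ih (hf' i) fun z => EReal.sum_ne_bot s fun i => hf' i z

theorem extIntegral_nnreal_smul_measure {Y : Type*} [MeasurableSpace Y] (μ : Measure Y)
    (f : Y → EReal) (a : ℝ≥0) :
    extIntegral (a • μ) f = ((a : ℝ) : EReal) * extIntegral μ f := by
  have ha : (0 : EReal) ≤ ((a : ℝ) : EReal) := by exact_mod_cast a.coe_nonneg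
  have hs : a • μ = (a : ℝ≥0∞) • μ := rfl
  rw [extIntegral, extIntegral, hs, lintegral_smul_measure, lintegral_smul_measure, sub_eq_add_neg,
    sub_eq_add_neg, EReal.left_distrib_of_nonneg_of_ne_top ha (EReal.coe_ne_top _), mul_neg,
    smul_eq_mul, smul_eq_mul, EReal.coe_ennreal_mul, EReal.coe_ennreal_mul,
    EReal.coe_nnreal_eq_coe_real]

theorem extIntegral_add_measure {Y : Type*} [MeasurableSpace Y] {μ ν : Measure Y}
    [IsFiniteMeasure μ] [IsFiniteMeasure ν] {f : Y → EReal}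
    (hf : Measurable f) {k : ℝ≥0} (hk : ∀ y, -(k : ℝ) ≤ f y) :
    extIntegral (μ + ν) f = extIntegral μ f + extIntegral ν f := by
  have : ∀ b : Bool, IsFiniteMeasure (bif b then μ else ν) := by
    rintro (_ | _) <;> simpa
  simpa using extIntegral_sum_measure (μ := fun b : Bool => bif b then μ else ν) hf hk

end ERealLemmas

/-! ### Transport plans as splittings, and the total cost -/

namespace AssignmentFlow

variable {X N : Type*} [MeasurableSpace X] (P : AssignmentFlow X N)

/-- The cost of the splitting `ρ` of the demand and of the flow `p`. -/
noncomputable def totalCost (ρ : MeasureSplitting P.stations P.μ) (p : P.arcs → ℝ) : EReal :=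
  ∑ i, extIntegral (ρ.1 i) (fun x => P.cost (x, i)) + ∑ e, P.arcCost e (p e)

/-- The transport plan with the given slices. -/
noncomputable def plan [MeasurableSpace N]
    (ρ : MeasureSplitting P.stations P.μ) : Measure (X × P.stations) :=
  ∑ i, (ρ.1 i).map fun x => (x, i)

section Cost

variable {P}

theorem totalCost_ne_bot [IsFiniteMeasure P.μ]
    (hcm : ∀ i, Measurable fun x => P.cost (x, i)) {k : ℝ≥0} (hk : ∀ z, -(k : ℝ) ≤ P.cost z)
    (hbot : ∀ e t, P.arcCost e t ≠ ⊥) (ρ : MeasureSplitting P.stations P.μ) (p : P.arcs → ℝ) :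
    P.totalCost ρ p ≠ ⊥ := fun h => (EReal.add_eq_bot_iff.1 h).elim
  (EReal.sum_ne_bot _ fun i => extIntegral_ne_bot (hcm i) fun _ => hk _)
  (EReal.sum_ne_bot _ fun e => hbot e _)

/-- After the shift by `k` each integral is lower semicontinuous, and the subtracted `k * ρ i (X)`
is continuous. Excluding `⊥` keeps the sums away from `⊤ + ⊥`. -/
theorem lowerSemicontinuous_totalCost [IsFiniteMeasure P.μ]
    (hcm : ∀ i, Measurable fun x => P.cost (x, i)) {k : ℝ≥0} (hk : ∀ z, -(k : ℝ) ≤ P.cost z)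
    (hbot : ∀ e t, P.arcCost e t ≠ ⊥) (hlsc : ∀ e, LowerSemicontinuous (P.arcCost e)) :
    LowerSemicontinuous fun z : MeasureSplitting P.stations P.μ × (P.arcs → ℝ) =>
      P.totalCost z.1 z.2 := by
  refine LowerSemicontinuous.ereal_add (LowerSemicontinuous.ereal_sum _ (fun i => ?_) ?_)
    (LowerSemicontinuous.ereal_sum _ (fun e => ?_) ?_) ?_ ?_
  · simp_rw [extIntegral_eq_lintegral_sub (hcm i) (fun _ => hk _), sub_eq_add_neg]
    refine LowerSemicontinuous.ereal_add ?_ (Continuous.lowerSemicontinuous ?_) (by simp) ?_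
    · exact (continuous_coe_ennreal_ereal.comp_lowerSemicontinuous
        (MeasureSplitting.lowerSemicontinuous_lintegral i _)
        fun _ _ h => EReal.coe_ennreal_le_coe_ennreal_iff.2 h).comp continuous_fst
    · simp_rw [← EReal.coe_neg]
      exact continuous_coe_real_ereal.comp ((continuous_const.mul
        ((MeasureSplitting.continuous_real_apply i .univ).comp continuous_fst)).neg)
    · exact fun z => by rw [← EReal.coe_neg]; exact EReal.coe_ne_bot _
  · exact fun i z => extIntegral_ne_bot (hcm i) fun _ => hk _
  · exact (hlsc e).comp ((continuous_apply e).comp continuous_snd)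
  · exact fun e z => hbot e _
  · exact fun z => EReal.sum_ne_bot _ fun i => extIntegral_ne_bot (hcm i) fun _ => hk _
  · exact fun z => EReal.sum_ne_bot _ fun e => hbot e _

theorem totalCost_combo_le [IsFiniteMeasure P.μ]
    (hcm : ∀ i, Measurable fun x => P.cost (x, i)) {k : ℝ≥0} (hk : ∀ z, -(k : ℝ) ≤ P.cost z)
    (hconv : ∀ e, ExtConvex (P.arcCost e))
    (ρ σ : MeasureSplitting P.stations P.μ) (p q : P.arcs → ℝ) (a b : ℝ≥0) (hab : a + b = 1) :
    P.totalCost (ρ.combo σ a b hab) (fun e => a * p e + b * q e) ≤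
      ((a : ℝ) : EReal) * P.totalCost ρ p + ((b : ℝ) : EReal) * P.totalCost σ q := by
  have hb : (b : ℝ) = 1 - a := by
    rw [eq_sub_iff_add_eq']
    exact_mod_cast hab
  have h0a : (0 : EReal) ≤ ((a : ℝ) : EReal) := by exact_mod_cast a.coe_nonneg
  have h0b : (0 : EReal) ≤ ((b : ℝ) : EReal) := by exact_mod_cast b.coe_nonneg
  have h1 : ∀ i, extIntegral ((ρ.combo σ a b hab).1 i) (fun x => P.cost (x, i)) =
      ((a : ℝ) : EReal) * extIntegral (ρ.1 i) (fun x => P.cost (x, i)) +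
        ((b : ℝ) : EReal) * extIntegral (σ.1 i) (fun x => P.cost (x, i)) := by
    intro i
    rw [← extIntegral_nnreal_smul_measure, ← extIntegral_nnreal_smul_measure,
      ← extIntegral_add_measure (hcm i) fun _ => hk _]
    rfl
  rw [totalCost, totalCost, totalCost,
    EReal.left_distrib_of_nonneg_of_ne_top h0a (EReal.coe_ne_top _),
    EReal.left_distrib_of_nonneg_of_ne_top h0b (EReal.coe_ne_top _),
    EReal.coe_mul_sum _ _ a.coe_nonneg, EReal.coe_mul_sum _ _ a.coe_nonneg,
    EReal.coe_mul_sum _ _ b.coe_nonneg, EReal.coe_mul_sum _ _ b.coe_nonneg, add_add_add_comm, ← Finset.sum_add_distrib,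
    ← Finset.sum_add_distrib]
  refine add_le_add (Finset.sum_le_sum fun i _ => (h1 i).le) (Finset.sum_le_sum fun e _ => ?_)
  have := hconv e (p e) (q e) a a.2 (by linarith [b.coe_nonneg])
  rwa [← hb] at this

theorem isCompact_limits [IsFiniteMeasure P.μ] :
    IsCompact {z : MeasureSplitting P.stations P.μ × (P.arcs → ℝ) |
      ∀ e, z.2 e ∈ Icc (P.lo e) (P.hi e)} := by
  have h := (isCompact_univ (X := MeasureSplitting P.stations P.μ)).prod
    (isCompact_univ_pi fun e : P.arcs => isCompact_Icc (a := P.lo e) (b := P.hi e))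
  convert h using 1
  ext z
  exact ⟨fun hz => ⟨mem_univ _, fun e _ => hz e⟩, fun hz e => hz.2 e (mem_univ e)⟩

end Cost

section Plan

variable [MeasurableSpace N]

theorem kantorovichCost_plan [IsFiniteMeasure P.μ]
    (hcm : Measurable P.cost) {k : ℝ≥0} (hk : ∀ z, -(k : ℝ) ≤ P.cost z)
    (ρ : MeasureSplitting P.stations P.μ) (p : P.arcs → ℝ) :
    P.kantorovichCost (P.plan ρ) p = P.totalCost ρ p := by
  have : ∀ i : P.stations, IsFiniteMeasure ((ρ.1 i).map fun x => (x, i)) := fun i =>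
    Measure.isFiniteMeasure_map _ _
  rw [kantorovichCost, totalCost, plan, extIntegral_sum_measure hcm hk]
  congr 1
  exact Finset.sum_congr rfl fun i _ => extIntegral_map measurable_prodMk_right hcm

variable [MeasurableSingletonClass N]

theorem plan_prod_singleton (ρ : MeasureSplitting P.stations P.μ) {A : Set X}
    (hA : MeasurableSet A) (i : P.stations) : P.plan ρ (A ×ˢ {i}) = ρ.1 i A := by
  have hm : MeasurableSet (A ×ˢ ({i} : Set P.stations)) := hA.prod (measurableSet_singleton i)
  rw [plan, Measure.finsetSum_apply, Finset.sum_eq_single i]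
  · rw [Measure.map_apply measurable_prodMk_right hm]
    congr 1
    ext x
    simp
  · intro j _ hj
    rw [Measure.map_apply measurable_prodMk_right hm]
    convert measure_empty (μ := ρ.1 j)
    ext x
    simp [hj]
  · simp

/-- The parts are the restrictions of `π` to the slices `X × {i}`, projected to `X`. -/
theorem exists_plan_eq {π : Measure (X × P.stations)}
    (hπ : ∀ A : Set X, MeasurableSet A → ∑ i : P.stations, π (A ×ˢ {i}) = P.μ A) :
    ∃ ρ, P.plan ρ = π := by
  have hms : ∀ i : P.stations, MeasurableSet ((univ : Set X) ×ˢ ({i} : Set P.stations)) :=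
    fun i => MeasurableSet.univ.prod (measurableSet_singleton i)
  have hfst : ∀ i : P.stations, ∀ A : Set X, MeasurableSet A →
      (π.restrict (univ ×ˢ {i})).map Prod.fst A = π (A ×ˢ {i}) := by
    intro i A hA
    rw [Measure.map_apply measurable_fst hA, Measure.restrict_apply (measurable_fst hA)]
    congr 1
    ext ⟨x, j⟩
    simp
  refine ⟨⟨fun i => (π.restrict (univ ×ˢ {i})).map Prod.fst, ?_⟩, ?_⟩
  · ext A hA
    rw [Measure.finsetSum_apply, ← hπ A hA]
    exact Finset.sum_congr rfl fun i _ => hfst i A hA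
  · ext B hB
    rw [plan, Measure.finsetSum_apply]
    have hBi : ∀ i : P.stations, MeasurableSet ((fun x : X => (x, i)) ⁻¹' B) :=
      fun i => measurable_prodMk_right hB
    have hterm : ∀ i : P.stations,
        ((π.restrict (univ ×ˢ {i})).map Prod.fst).map (fun x => (x, i)) B
          = π (B ∩ univ ×ˢ {i}) := by
      intro i
      rw [Measure.map_apply measurable_prodMk_right hB, hfst i _ (hBi i)]
      congr 1
      ext ⟨x, j⟩
      simp only [mem_prod, mem_preimage, mem_singleton_iff, mem_inter_iff, mem_univ, true_and]
      exact ⟨fun h => ⟨h.2 ▸ h.1, h.2⟩, fun h => ⟨h.2 ▸ h.1, h.2⟩⟩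
    simp_rw [hterm]
    rw [← measure_biUnion_finset]
    · congr 1
      ext ⟨x, j⟩
      simp
    · intro i _ j _ hij
      refine Set.disjoint_left.2 ?_
      rintro ⟨x, l⟩ hi hj
      exact hij (hi.2.2.symm.trans hj.2.2)
    · exact fun i _ => hB.inter (hms i)

end Plan

/-! ### Perturbed supplies and the epigraph of the value function -/

variable [DecidableEq N]

/-- The amount of supply used at the node `i` by the splitting `ρ` of the demand and the
flow `p`. -/
noncomputable def balance (ρ : MeasureSplitting P.stations P.μ) (p : P.arcs → ℝ) (i : N) : ℝ :=
  P.netOutflow p i + if h : i ∈ P.stations then (ρ.1 ⟨i, h⟩).real univ else 0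

/-- The epigraph of the optimal value as a function of the supplies. -/
def valueEpigraph : Set ((N → ℝ) × ℝ) :=
  {z | ∃ (ρ : MeasureSplitting P.stations P.μ) (p : P.arcs → ℝ),
    (∀ e, p e ∈ Icc (P.lo e) (P.hi e)) ∧ P.balance ρ p = z.1 ∧ P.totalCost ρ p ≤ (z.2 : EReal)}

theorem flowFeasible_iff [IsFiniteMeasure P.μ] (ρ : MeasureSplitting P.stations P.μ)
    (p : P.arcs → ℝ) : P.FlowFeasible (fun i => ρ.1 i univ) p ↔
      P.balance ρ p = P.supply ∧ ∀ e, p e ∈ Icc (P.lo e) (P.hi e) := by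
  have key : ∀ i : P.stations, (P.netOutflow p i : EReal) =
      (P.supply i : EReal) - ((ρ.1 i univ : ℝ≥0∞) : EReal) ↔ P.balance ρ p i = P.supply i := by
    intro i
    have h1 : ((ρ.1 i univ : ℝ≥0∞) : EReal) = (((ρ.1 i).real univ : ℝ) : EReal) := by
      rw [Measure.real, EReal.coe_ennreal_toReal (measure_ne_top _ _)]
    rw [h1, ← EReal.coe_sub, EReal.coe_eq_coe_iff, balance, dif_pos i.2]
    exact eq_sub_iff_add_eq
  constructor
  · rintro ⟨h1, h2, h3⟩
    refine ⟨funext fun i => ?_, h3⟩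
    by_cases hi : i ∈ P.stations
    · exact (key ⟨i, hi⟩).1 (h1 ⟨i, hi⟩)
    · rw [balance, dif_neg hi, add_zero, h2 i hi]
  · rintro ⟨h1, h2⟩
    refine ⟨fun i => (key i).2 (congrFun h1 i), fun i hi => ?_, h2⟩
    have := congrFun h1 i
    rwa [balance, dif_neg hi, add_zero] at this

theorem kantorovichFeasible_plan_iff [MeasurableSpace N] [MeasurableSingletonClass N]
    [IsFiniteMeasure P.μ]
    (ρ : MeasureSplitting P.stations P.μ) (p : P.arcs → ℝ) :
    P.KantorovichFeasible (P.plan ρ) p ↔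
      P.balance ρ p = P.supply ∧ ∀ e, p e ∈ Icc (P.lo e) (P.hi e) := by
  rw [← flowFeasible_iff, KantorovichFeasible]
  simp_rw [P.plan_prod_singleton ρ MeasurableSet.univ]
  refine and_iff_right fun A hA => ?_
  simp_rw [P.plan_prod_singleton ρ hA, ρ.sum_apply]

theorem kantorovichValue_eq [MeasurableSpace N] [MeasurableSingletonClass N] [IsFiniteMeasure P.μ]
    (hcm : Measurable P.cost) {k : ℝ≥0} (hk : ∀ z, -(k : ℝ) ≤ P.cost z) :
    P.kantorovichValue = ⨅ (ρ : MeasureSplitting P.stations P.μ) (p : P.arcs → ℝ)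
      (_ : P.balance ρ p = P.supply ∧ ∀ e, p e ∈ Icc (P.lo e) (P.hi e)), P.totalCost ρ p := by
  refine le_antisymm ?_ ?_
  · refine le_iInf fun ρ => le_iInf fun p => le_iInf fun h => ?_
    rw [← P.kantorovichCost_plan hcm hk]
    exact iInf₂_le_of_le (P.plan ρ) p
      (iInf_le_of_le ((P.kantorovichFeasible_plan_iff ρ p).2 h) le_rfl)
  · refine le_iInf fun π => le_iInf fun p => le_iInf fun h => ?_
    obtain ⟨ρ, rfl⟩ := P.exists_plan_eq h.1
    rw [P.kantorovichCost_plan hcm hk]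
    exact iInf₂_le_of_le ρ p (iInf_le_of_le ((P.kantorovichFeasible_plan_iff ρ p).1 h) le_rfl)

variable {P}

theorem netOutflow_combo (p q : P.arcs → ℝ) (a b : ℝ) (i : N) :
    P.netOutflow (fun e => a * p e + b * q e) i = a * P.netOutflow p i + b * P.netOutflow q i := by
  simp only [netOutflow, mul_sub, Finset.mul_sum, mul_ite, mul_zero]
  rw [sub_add_sub_comm, ← Finset.sum_add_distrib, ← Finset.sum_add_distrib]
  congr 1 <;> refine Finset.sum_congr rfl fun e _ => ?_ <;> split_ifs <;> simp

variable [IsFiniteMeasure P.μ]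

theorem continuous_balance :
    Continuous fun z : MeasureSplitting P.stations P.μ × (P.arcs → ℝ) => P.balance z.1 z.2 := by
  refine continuous_pi fun i => Continuous.add ?_ ?_
  · unfold netOutflow
    refine Continuous.sub (continuous_finsetSum _ fun e _ => ?_)
      (continuous_finsetSum _ fun e _ => ?_) <;> split_ifs <;> fun_prop
  · split_ifs with h
    · exact (MeasureSplitting.continuous_real_apply _ .univ).comp continuous_fst
    · exact continuous_const

/-- The epigraph is the image of a closed set under the projection that forgets `(ρ, p)`, which
ranges over a compact space. -/
theorem isClosed_valueEpigraph
    (hcm : ∀ i, Measurable fun x => P.cost (x, i)) {k : ℝ≥0} (hk : ∀ z, -(k : ℝ) ≤ P.cost z)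
    (hbot : ∀ e t, P.arcCost e t ≠ ⊥) (hlsc : ∀ e, LowerSemicontinuous (P.arcCost e)) :
    IsClosed P.valueEpigraph := by
  let K := {z : MeasureSplitting P.stations P.μ × (P.arcs → ℝ) |
      ∀ e, z.2 e ∈ Icc (P.lo e) (P.hi e)}
  have : CompactSpace K := isCompact_iff_compactSpace.1 isCompact_limits
  let S : Set (K × ((N → ℝ) × ℝ)) := {w | P.balance w.1.1.1 w.1.1.2 = w.2.1 ∧
    P.totalCost w.1.1.1 w.1.1.2 ≤ (w.2.2 : EReal)}
  have hS : IsClosed S := by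
    refine IsClosed.inter ?_ ?_
    · exact isClosed_eq (continuous_balance.comp (continuous_subtype_val.comp continuous_fst))
        (by fun_prop)
    · have h := (lowerSemicontinuous_totalCost hcm hk hbot hlsc).isClosed_epigraph
      exact h.preimage (f := fun w : K × ((N → ℝ) × ℝ) => (w.1.1, ((w.2.2 : ℝ) : EReal)))
        ((continuous_subtype_val.comp continuous_fst).prodMk
          (continuous_coe_real_ereal.comp (continuous_snd.comp continuous_snd)))
  convert isClosedMap_snd_of_compactSpace S hS using 1
  ext z
  constructor
  · rintro ⟨ρ, p, h1, h2, h3⟩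
    exact ⟨(⟨(ρ, p), h1⟩, z), ⟨h2, h3⟩, rfl⟩
  · rintro ⟨⟨⟨⟨ρ, p⟩, h1⟩, z'⟩, ⟨h2, h3⟩, rfl⟩
    exact ⟨ρ, p, h1, h2, h3⟩

theorem balance_combo (ρ σ : MeasureSplitting P.stations P.μ) (p q : P.arcs → ℝ) (a b : ℝ≥0)
    (hab : a + b = 1) (i : N) :
    P.balance (ρ.combo σ a b hab) (fun e => a * p e + b * q e) i =
      a * P.balance ρ p i + b * P.balance σ q i := by
  rw [balance, netOutflow_combo, balance, balance]
  by_cases hi : i ∈ P.stations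
  · simp only [dif_pos hi, MeasureSplitting.combo]
    rw [measureReal_add_apply, measureReal_nnreal_smul_apply, measureReal_nnreal_smul_apply]
    ring
  · simp only [dif_neg hi]
    ring

theorem convex_valueEpigraph
    (hcm : ∀ i, Measurable fun x => P.cost (x, i)) {k : ℝ≥0} (hk : ∀ z, -(k : ℝ) ≤ P.cost z)
    (hconv : ∀ e, ExtConvex (P.arcCost e)) : Convex ℝ P.valueEpigraph := by
  rintro z ⟨ρ, p, hp, hz, hzr⟩ w ⟨σ, q, hq, hw, hwr⟩ a b ha hb hab
  lift a to ℝ≥0 using ha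
  lift b to ℝ≥0 using hb
  have hab' : a + b = 1 := by exact_mod_cast hab
  refine ⟨ρ.combo σ a b hab', fun e => a * p e + b * q e, fun e => ?_, ?_, ?_⟩
  · exact convex_Icc (P.lo e) (P.hi e) (hp e) (hq e) a.2 b.2 hab
  · ext i
    rw [balance_combo, hz, hw]
    rfl
  · refine (totalCost_combo_le hcm hk hconv ρ σ p q a b hab').trans ?_
    have h0a : (0 : EReal) ≤ ((a : ℝ) : EReal) := by exact_mod_cast a.coe_nonneg
    have h0b : (0 : EReal) ≤ ((b : ℝ) : EReal) := by exact_mod_cast b.coe_nonneg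
    refine (add_le_add (mul_le_mul_of_nonneg_left hzr h0a)
      (mul_le_mul_of_nonneg_left hwr h0b)).trans (le_of_eq ?_)
    simp

end AssignmentFlow

/-! ### Lagrangian duality -/

namespace AssignmentFlow

variable {X N : Type*} [MeasurableSpace X] {P : AssignmentFlow X N}

theorem exists_isMinOn_reducedArcCost (hbot : ∀ e t, P.arcCost e t ≠ ⊥)
    (hlsc : ∀ e, LowerSemicontinuous (P.arcCost e)) (ψ : N → ℝ) (e : P.arcs)
    (hle : P.lo e ≤ P.hi e) : ∃ t ∈ Icc (P.lo e) (P.hi e),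
      IsMinOn (P.reducedArcCost ψ e) (Icc (P.lo e) (P.hi e)) t := by
  refine LowerSemicontinuousOn.exists_isMinOn ⟨P.lo e, left_mem_Icc.2 hle⟩ isCompact_Icc
    (LowerSemicontinuous.lowerSemicontinuousOn ?_ _)
  unfold reducedArcCost
  simp_rw [sub_eq_add_neg, ← EReal.coe_neg]
  exact (hlsc e).ereal_add (continuous_coe_real_ereal.comp (by fun_prop)).lowerSemicontinuous
    (hbot e) fun _ => EReal.coe_ne_bot _

theorem exists_bound_cost_sub {k : ℝ≥0} (hk : ∀ z, -(k : ℝ) ≤ P.cost z) (ψ : N → ℝ) :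
    ∃ l : ℝ≥0, ∀ x (i : P.stations), -(l : ℝ) ≤ P.cost (x, i) - (ψ i : EReal) := by
  refine ⟨k + ∑ i : P.stations, ‖ψ i‖₊, fun x i => ?_⟩
  have h1 : |ψ i| ≤ ∑ j : P.stations, |ψ j| :=
    Finset.single_le_sum (f := fun j : P.stations => |ψ j|) (fun _ _ => abs_nonneg _)
      (Finset.mem_univ i)
  rw [sub_eq_add_neg, ← EReal.coe_neg]
  refine le_trans ?_ (add_le_add_left (hk (x, i)) _)
  rw [← EReal.coe_neg, ← EReal.coe_neg, ← EReal.coe_add, EReal.coe_le_coe_iff]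
  push_cast
  simp only [Real.norm_eq_abs]
  linarith [le_abs_self (ψ i)]

theorem measurable_iInf_cost_sub (hcm : ∀ i, Measurable fun x => P.cost (x, i)) (ψ : N → ℝ) :
    Measurable fun x => ⨅ i : P.stations, (P.cost (x, i) - (ψ i : EReal)) := by
  refine .iInf fun i => ?_
  simpa [sub_eq_add_neg, ← EReal.coe_neg] using measurable_ereal_add_coe (hcm i) (-ψ i)

theorem exists_isMin_totalCost [DecidableEq N] [IsFiniteMeasure P.μ]
    (hcm : ∀ i, Measurable fun x => P.cost (x, i)) {k : ℝ≥0}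
    (hk : ∀ z, -(k : ℝ) ≤ P.cost z) (hbot : ∀ e t, P.arcCost e t ≠ ⊥)
    (hlsc : ∀ e, LowerSemicontinuous (P.arcCost e))
    (hfeas : ∃ (ρ : MeasureSplitting P.stations P.μ) (p : P.arcs → ℝ),
      P.balance ρ p = P.supply ∧ ∀ e, p e ∈ Icc (P.lo e) (P.hi e)) :
    ∃ (ρ : MeasureSplitting P.stations P.μ) (p : P.arcs → ℝ),
      (P.balance ρ p = P.supply ∧ ∀ e, p e ∈ Icc (P.lo e) (P.hi e)) ∧
      ∀ (σ : MeasureSplitting P.stations P.μ) (q : P.arcs → ℝ),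
        P.balance σ q = P.supply ∧ (∀ e, q e ∈ Icc (P.lo e) (P.hi e)) →
          P.totalCost ρ p ≤ P.totalCost σ q := by
  obtain ⟨ρ₀, p₀, h₀⟩ := hfeas
  have hcpt : IsCompact ({z : MeasureSplitting P.stations P.μ × (P.arcs → ℝ) |
      ∀ e, z.2 e ∈ Icc (P.lo e) (P.hi e)} ∩ {z | P.balance z.1 z.2 = P.supply}) :=
    isCompact_limits.inter_right (isClosed_eq continuous_balance continuous_const)
  obtain ⟨⟨ρ, p⟩, hmem, hmin⟩ := LowerSemicontinuousOn.exists_isMinOn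
    (by exact ⟨(ρ₀, p₀), h₀.2, h₀.1⟩) hcpt
    ((lowerSemicontinuous_totalCost hcm hk hbot hlsc).lowerSemicontinuousOn _)
  exact ⟨ρ, p, ⟨hmem.2, hmem.1⟩, fun σ q h => hmin (a := (σ, q)) ⟨h.2, h.1⟩⟩

variable [Fintype N]

theorem dual_eq [IsFiniteMeasure P.μ] (hcm : ∀ i, Measurable fun x => P.cost (x, i)) {k : ℝ≥0}
    (hk : ∀ z, -(k : ℝ) ≤ P.cost z) (ψ : N → ℝ) (ρ : MeasureSplitting P.stations P.μ) :
    P.dual ψ =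
      ∑ j, extIntegral (ρ.1 j) (fun x => ⨅ i : P.stations, (P.cost (x, i) - (ψ i : EReal)))
      + ((∑ i : N, ψ i * P.supply i : ℝ) : EReal)
      + ∑ e : P.arcs, ⨅ t ∈ Icc (P.lo e) (P.hi e), P.reducedArcCost ψ e t := by
  obtain ⟨l, hl⟩ := exists_bound_cost_sub hk ψ
  rw [dual, ← extIntegral_sum_measure (measurable_iInf_cost_sub hcm ψ) fun x => le_iInf (hl x),
    ρ.2]

variable [DecidableEq N]

theorem sum_mul_netOutflow (ψ : N → ℝ) (p : P.arcs → ℝ) :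
    ∑ i, ψ i * P.netOutflow p i = ∑ e : P.arcs, (ψ e.1.1 - ψ e.1.2) * p e := by
  simp only [netOutflow, mul_sub, Finset.mul_sum, Finset.sum_sub_distrib, sub_mul]
  rw [Finset.sum_comm, Finset.sum_comm (s := (Finset.univ : Finset N))]
  simp

theorem sum_mul_balance (ψ : N → ℝ) (ρ : MeasureSplitting P.stations P.μ) (p : P.arcs → ℝ) :
    ∑ i, ψ i * P.balance ρ p i = ∑ e : P.arcs, (ψ e.1.1 - ψ e.1.2) * p e +
      ∑ i : P.stations, ψ i * (ρ.1 i).real univ := by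
  simp only [balance, mul_add, Finset.sum_add_distrib, sum_mul_netOutflow, mul_dite, mul_zero]
  congr 1
  rw [← Finset.sum_subset (Finset.subset_univ P.stations), ← Finset.sum_coe_sort]
  · exact Finset.sum_congr rfl fun i _ => by rw [dif_pos i.2]
  · intro i _ hi
    rw [dif_neg hi]

variable [IsFiniteMeasure P.μ]

/-- Summation by parts on the graph turns node prices into arc price differences, so the Lagrangian
separates over stations and arcs. -/
theorem lagrangian_eq (hcm : ∀ i, Measurable fun x => P.cost (x, i)) {k : ℝ≥0}
    (hk : ∀ z, -(k : ℝ) ≤ P.cost z) (ψ : N → ℝ) (ρ : MeasureSplitting P.stations P.μ)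
    (p : P.arcs → ℝ) :
    ∑ i, extIntegral (ρ.1 i) (fun x => P.cost (x, i) - (ψ i : EReal))
        + ((∑ i : N, ψ i * P.supply i : ℝ) : EReal) + ∑ e, P.reducedArcCost ψ e (p e)
      = P.totalCost ρ p + ((∑ i, ψ i * (P.supply i - P.balance ρ p i) : ℝ) : EReal) := by
  have h : ∑ i, ψ i * (P.supply i - P.balance ρ p i) = ∑ i, ψ i * P.supply i +
      -(∑ e : P.arcs, (ψ e.1.1 - ψ e.1.2) * p e) +
        -(∑ i : P.stations, ψ i * (ρ.1 i).real univ) := by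
    simp only [mul_sub, Finset.sum_sub_distrib, sum_mul_balance]
    ring
  simp_rw [extIntegral_sub_coe (hcm _) (fun _ => hk _), reducedArcCost, EReal.sum_sub_coe]
  rw [h, EReal.coe_add, EReal.coe_add, EReal.coe_neg, EReal.coe_neg, totalCost, sub_eq_add_neg,
    sub_eq_add_neg]
  ac_rfl

theorem dual_le (hcm : ∀ i, Measurable fun x => P.cost (x, i)) {k : ℝ≥0}
    (hk : ∀ z, -(k : ℝ) ≤ P.cost z) (ψ : N → ℝ) (ρ : MeasureSplitting P.stations P.μ)
    {p : P.arcs → ℝ} (hp : ∀ e, p e ∈ Icc (P.lo e) (P.hi e)) :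
    P.dual ψ ≤
      P.totalCost ρ p + ((∑ i, ψ i * (P.supply i - P.balance ρ p i) : ℝ) : EReal) := by
  rw [← lagrangian_eq hcm hk, dual_eq hcm hk ψ ρ]
  gcongr with i _ e _
  · exact extIntegral_mono fun x => iInf_le _ i
  · exact iInf₂_le (p e) (hp e)

/-- The separated terms are minimized independently: each `x` goes to a station of least reduced
cost, chosen measurably, and each arc carries an optimal flow. -/
theorem exists_dual_eq (hcm : ∀ i, Measurable fun x => P.cost (x, i)) {k : ℝ≥0}
    (hk : ∀ z, -(k : ℝ) ≤ P.cost z) (hbot : ∀ e t, P.arcCost e t ≠ ⊥)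
    (hlsc : ∀ e, LowerSemicontinuous (P.arcCost e)) (hle : ∀ e, P.lo e ≤ P.hi e)
    (hne : X → P.stations) (ψ : N → ℝ) :
    ∃ (ρ : MeasureSplitting P.stations P.μ) (p : P.arcs → ℝ),
      (∀ e, p e ∈ Icc (P.lo e) (P.hi e)) ∧ P.dual ψ =
        P.totalCost ρ p + ((∑ i, ψ i * (P.supply i - P.balance ρ p i) : ℝ) : EReal) := by
  let _ : MeasurableSpace P.stations := ⊤
  obtain ⟨T, hT, hmin⟩ := exists_measurable_isMin
    (fun (i : P.stations) x => P.cost (x, i) - (ψ i : EReal))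
    (fun i => by
      simpa [sub_eq_add_neg, ← EReal.coe_neg] using measurable_ereal_add_coe (hcm i) (-ψ i)) hne
  have hTm : ∀ i, MeasurableSet (T ⁻¹' {i}) := fun i => hT trivial
  choose p hp hpmin using fun e => exists_isMinOn_reducedArcCost hbot hlsc ψ e (hle e)
  refine ⟨.ofMap hTm, p, hp, ?_⟩
  rw [← lagrangian_eq hcm hk, dual_eq hcm hk ψ (.ofMap hTm)]
  congr 1
  · congr 1
    refine Finset.sum_congr rfl fun i _ => extIntegral_congr_ae ?_
    refine (ae_restrict_iff' (hTm i)).2 (.of_forall fun x hx => ?_)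
    obtain rfl : T x = i := hx
    exact le_antisymm (iInf_le _ _) (le_iInf fun j => hmin x j)
  · refine Finset.sum_congr rfl fun e _ => ?_
    exact le_antisymm (iInf₂_le (p e) (hp e)) (le_iInf₂ fun t ht => hpmin e ht)

theorem le_dual_of_forall_valueEpigraph (hcm : ∀ i, Measurable fun x => P.cost (x, i)) {k : ℝ≥0}
    (hk : ∀ z, -(k : ℝ) ≤ P.cost z) (hbot : ∀ e t, P.arcCost e t ≠ ⊥)
    (hlsc : ∀ e, LowerSemicontinuous (P.arcCost e)) (hle : ∀ e, P.lo e ≤ P.hi e)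
    (hne : X → P.stations) (ψ : N → ℝ) {α : ℝ}
    (h : ∀ z ∈ P.valueEpigraph, α ≤ z.2 + ∑ i, ψ i * (P.supply i - z.1 i)) :
    (α : EReal) ≤ P.dual ψ := by
  obtain ⟨ρ, p, hp, heq⟩ := exists_dual_eq hcm hk hbot hlsc hle hne ψ
  rw [heq]
  have hC : P.totalCost ρ p ≠ ⊥ := totalCost_ne_bot hcm hk hbot ρ p
  have hmem : ∀ r : ℝ, P.totalCost ρ p = r → (P.balance ρ p, r) ∈ P.valueEpigraph :=
    fun r hr => ⟨ρ, p, hp, rfl, hr.le⟩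
  generalize P.totalCost ρ p = C at hC hmem
  induction C with
  | bot => exact absurd rfl hC
  | top => simp
  | coe r =>
    rw [← EReal.coe_add, EReal.coe_le_coe_iff]
    exact h _ (hmem r rfl)

/-- At `ψ = 0` the Lagrangian is the cost itself, so `dual 0` bounds the epigraph from below. -/
theorem exists_le_valueEpigraph (hcm : ∀ i, Measurable fun x => P.cost (x, i)) {k : ℝ≥0}
    (hk : ∀ z, -(k : ℝ) ≤ P.cost z) (hbot : ∀ e t, P.arcCost e t ≠ ⊥)
    (hlsc : ∀ e, LowerSemicontinuous (P.arcCost e)) (hle : ∀ e, P.lo e ≤ P.hi e)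
    (hne : X → P.stations) : ∃ b : ℝ, ∀ z ∈ P.valueEpigraph, b ≤ z.2 := by
  have h1 : ∀ z ∈ P.valueEpigraph, P.dual 0 ≤ (z.2 : EReal) := by
    rintro z ⟨ρ, p, hp, -, hz⟩
    have := dual_le hcm hk 0 ρ hp
    simp only [Pi.zero_apply, zero_mul, Finset.sum_const_zero, EReal.coe_zero, add_zero] at this
    exact this.trans hz
  have h2 : P.dual 0 ≠ ⊥ := by
    obtain ⟨ρ, p, hp, heq⟩ := exists_dual_eq hcm hk hbot hlsc hle hne 0
    rw [heq]
    simpa using totalCost_ne_bot hcm hk hbot ρ p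
  generalize P.dual 0 = d at h1 h2
  induction d with
  | bot => exact absurd rfl h2
  | top => exact ⟨0, fun z hz => absurd (h1 z hz) (by simp)⟩
  | coe b => exact ⟨b, fun z hz => EReal.coe_le_coe_iff.1 (h1 z hz)⟩

theorem exists_le_dual (hcm : ∀ i, Measurable fun x => P.cost (x, i)) {k : ℝ≥0}
    (hk : ∀ z, -(k : ℝ) ≤ P.cost z) (hbot : ∀ e t, P.arcCost e t ≠ ⊥)
    (hconv : ∀ e, ExtConvex (P.arcCost e))
    (hlsc : ∀ e, LowerSemicontinuous (P.arcCost e)) (hle : ∀ e, P.lo e ≤ P.hi e)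
    (hne : X → P.stations) {α : ℝ} (hα : (P.supply, α) ∉ P.valueEpigraph) :
    ∃ ψ : N → ℝ, (α : EReal) ≤ P.dual ψ := by
  have hdual : ∀ ψ : N → ℝ, (∀ z ∈ P.valueEpigraph,
      α ≤ z.2 + ∑ i, ψ i * (P.supply i - z.1 i)) → (α : EReal) ≤ P.dual ψ := fun ψ =>
    le_dual_of_forall_valueEpigraph hcm hk hbot hlsc hle hne ψ
  rcases eq_empty_or_nonempty P.valueEpigraph with hemp | ⟨z₀, hz₀⟩
  · exact ⟨0, hdual 0 (by simp [hemp])⟩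
  obtain ⟨f, c, hfc, hcf⟩ := geometric_hahn_banach_point_closed
    (convex_valueEpigraph hcm hk hconv) (isClosed_valueEpigraph hcm hk hbot hlsc) hα
  obtain ⟨b, hb⟩ := exists_le_valueEpigraph hcm hk hbot hlsc hle hne
  set φ : N → ℝ := fun i => f (Pi.single i 1, 0) with hφ
  set lam : ℝ := f (0, 1) with hlam
  have hf : ∀ z : (N → ℝ) × ℝ, f z = ∑ i, φ i * z.1 i + lam * z.2 := by
    rintro ⟨u, r⟩
    have h1 : ((u, r) : (N → ℝ) × ℝ) = (u, 0) + r • ((0, 1) : (N → ℝ) × ℝ) := by simp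
    have h2 := LinearMap.pi_apply_eq_sum_univ
      ((f : ((N → ℝ) × ℝ) →ₗ[ℝ] ℝ) ∘ₗ LinearMap.inl ℝ (N → ℝ) ℝ) u
    simp only [LinearMap.comp_apply, LinearMap.inl_apply, ContinuousLinearMap.coe_coe] at h2
    rw [h1, map_add, map_smul, h2, smul_eq_mul, ← hlam, mul_comm r]
    simp only [smul_eq_mul, Prod.fst_add, Prod.snd_add, Prod.smul_fst, Prod.smul_snd, smul_zero,
      add_zero, zero_add, mul_one]
    congr 1
    refine Finset.sum_congr rfl fun i _ => ?_
    rw [mul_comm, hφ]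
    congr 3
    ext j
    simp [Pi.single_apply, eq_comm]
  have hup : ∀ t : ℝ, 0 ≤ t → (z₀.1, z₀.2 + t) ∈ P.valueEpigraph := by
    intro t ht
    obtain ⟨ρ, p, hp, h1, h2⟩ := hz₀
    exact ⟨ρ, p, hp, h1, h2.trans (by exact_mod_cast (by linarith : z₀.2 ≤ z₀.2 + t))⟩
  -- The epigraph is closed upwards. If `lam < 0`, raising `z₀` by `(f z₀ - c) / (-lam)` would bring
  -- `f` down to exactly `c`.
  have hlam0 : 0 ≤ lam := by
    by_contra! hneg
    have h0 := hcf _ hz₀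
    have h1 := hcf _ (hup ((f z₀ - c) / (-lam)) (div_nonneg (by linarith) (by linarith)))
    rw [hf] at h1
    have h2 : lam * ((f z₀ - c) / (-lam)) = -(f z₀ - c) := by
      rw [div_neg, mul_neg, mul_div_cancel₀ _ hneg.ne]
    have h3 := hf z₀
    simp only [mul_add, h2] at h1
    linarith
  have hsep : ∀ z ∈ P.valueEpigraph,
      ∑ i, φ i * P.supply i + lam * α < ∑ i, φ i * z.1 i + lam * z.2 := fun z hz => by
    have := hfc.trans (hcf z hz)
    rwa [hf, hf] at this
  have hsum : ∀ (d : ℝ) (u : N → ℝ), ∑ i, (-(d * φ i)) * (P.supply i - u i)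
      = d * (∑ i, φ i * u i - ∑ i, φ i * P.supply i) := fun d u => by
    rw [← Finset.sum_sub_distrib, Finset.mul_sum]
    exact Finset.sum_congr rfl fun i _ => by ring
  rcases hlam0.eq_or_lt with h0 | hpos
  · -- vertical hyperplane: move far along its normal
    have hδ : 0 < c - ∑ i, φ i * P.supply i := by
      rw [hf] at hfc
      simp only [← h0, zero_mul, add_zero] at hfc
      linarith
    set δ := c - ∑ i, φ i * P.supply i
    -- The normal separates the supplies by at least `δ`, so this multiple contributes at least `|α
    -- - b|`, lifting the bound `b` to `α`.
    refine ⟨fun i => -((|α - b| / δ) * φ i), hdual _ fun z hz => ?_⟩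
    rw [hsum]
    have h1 := hcf z hz
    rw [hf, ← h0, zero_mul, add_zero] at h1
    have h2 : (|α - b| / δ) * δ ≤ (|α - b| / δ) * (∑ i, φ i * z.1 i - ∑ i, φ i * P.supply i) :=
      mul_le_mul_of_nonneg_left (by simp only [δ]; linarith) (by positivity)
    rw [div_mul_cancel₀ _ hδ.ne'] at h2
    linarith [hb z hz, le_abs_self (α - b)]
  -- A non-vertical hyperplane, normalized to have coefficient `1` on the cost.
  · refine ⟨fun i => -(lam⁻¹ * φ i), hdual _ fun z hz => ?_⟩
    rw [hsum]
    have h1 := mul_le_mul_of_nonneg_left (hsep z hz).le (inv_nonneg.2 hpos.le)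
    rw [mul_add, mul_add, inv_mul_cancel_left₀ hpos.ne', inv_mul_cancel_left₀ hpos.ne'] at h1
    linarith

/-- A Lagrangian minimizer at the intermediate price bounds the dual at both endpoints, and for
fixed `(ρ, p)` the Lagrangian is affine in the price. -/
theorem dual_concave (hcm : ∀ i, Measurable fun x => P.cost (x, i)) {k : ℝ≥0}
    (hk : ∀ z, -(k : ℝ) ≤ P.cost z) (hbot : ∀ e t, P.arcCost e t ≠ ⊥)
    (hlsc : ∀ e, LowerSemicontinuous (P.arcCost e)) (hle : ∀ e, P.lo e ≤ P.hi e)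
    (hne : X → P.stations) (ψ φ : N → ℝ) {t : ℝ} (h0 : 0 ≤ t) (h1 : t ≤ 1) :
    (t : EReal) * P.dual ψ + ((1 - t : ℝ) : EReal) * P.dual φ
      ≤ P.dual (t • ψ + (1 - t) • φ) := by
  obtain ⟨ρ, p, hp, heq⟩ := exists_dual_eq hcm hk hbot hlsc hle hne (t • ψ + (1 - t) • φ)
  have hψ := dual_le hcm hk ψ ρ hp
  have hφ := dual_le hcm hk φ ρ hp
  have hC : P.totalCost ρ p ≠ ⊥ := totalCost_ne_bot hcm hk hbot ρ p
  rw [heq]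
  generalize P.totalCost ρ p = C at hψ hφ hC
  induction C with
  | bot => exact absurd rfl hC
  | top => simp
  | coe r =>
    rw [← EReal.coe_add] at hψ hφ ⊢
    refine (add_le_add (mul_le_mul_of_nonneg_left hψ (by exact_mod_cast h0))
      (mul_le_mul_of_nonneg_left hφ (by exact_mod_cast sub_nonneg.2 h1))).trans (le_of_eq ?_)
    rw [← EReal.coe_mul, ← EReal.coe_mul, ← EReal.coe_add]
    congr 1
    simp only [Pi.add_apply, Pi.smul_apply, smul_eq_mul, add_mul, Finset.sum_add_distrib, mul_assoc,
      ← Finset.mul_sum]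
    ring

end AssignmentFlow

/-! ### Finiteness of the demand and the main theorem -/

theorem EReal.exists_nnreal_neg_le {ι : Type*} {f : ι → EReal}
    (h : ∃ m : ℝ, ∀ z, (m : EReal) ≤ f z) :
    ∃ k : ℝ≥0, ∀ z, -(k : ℝ) ≤ f z := by
  obtain ⟨m, hm⟩ := h
  refine ⟨‖m‖₊, fun z => le_trans ?_ (hm z)⟩
  rw [← EReal.coe_neg, EReal.coe_le_coe_iff]
  exact neg_abs_le m

theorem AssignmentFlow.FlowFeasible.load_ne_top {X N : Type*} [MeasurableSpace X] [DecidableEq N]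
    {P : AssignmentFlow X N} {load : P.stations → ℝ≥0∞} {p : P.arcs → ℝ}
    (h : P.FlowFeasible load p) (i : P.stations) : load i ≠ ⊤ := by
  intro hi
  have := h.station i
  rw [hi, EReal.coe_ennreal_top, EReal.sub_top] at this
  exact EReal.coe_ne_bot _ this

theorem theorem1 {X N : Type*}
    [TopologicalSpace X] [CompactSpace X] [MeasurableSpace X] [OpensMeasurableSpace X]
    [Fintype N] [DecidableEq N] [TopologicalSpace N] [DiscreteTopology N]
    [MeasurableSpace N] [MeasurableSingletonClass N]
    (P : AssignmentFlow X N)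
    (hc : LowerSemicontinuous P.cost)
    (hc_bdd : ∃ m : ℝ, ∀ z, (m : EReal) ≤ P.cost z)
    (harc_ne_bot : ∀ e t, P.arcCost e t ≠ ⊥)
    (harc_convex : ∀ e, ExtConvex (P.arcCost e))
    (harc_lsc : ∀ e, LowerSemicontinuous (P.arcCost e))
    (hfeas : ∃ T p, P.MongeFeasible T p) :
    -- strong duality
    P.kantorovichValue = (⨆ ψ : N → ℝ, P.dual ψ) ∧
    -- the infimum of the relaxation is attained
    (∃ π p, P.KantorovichFeasible π p ∧ P.kantorovichCost π p = P.kantorovichValue) ∧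
    -- the minima over the arc flows in the dual function are attained
    (∀ (ψ : N → ℝ) (e : P.arcs), ∃ t ∈ Icc (P.lo e) (P.hi e),
      IsMinOn (P.reducedArcCost ψ e) (Icc (P.lo e) (P.hi e)) t) ∧
    -- the dual function is real-valued, unless the relaxation only has infinite cost
    (∀ ψ : N → ℝ, P.dual ψ ≠ ⊥) ∧
    (P.kantorovichValue ≠ ⊤ → ∀ ψ : N → ℝ, P.dual ψ ≠ ⊤) ∧
    -- the dual function is concave
    (∀ (ψ φ : N → ℝ) (t : ℝ), 0 ≤ t → t ≤ 1 →
      (t : EReal) * P.dual ψ + ((1 - t : ℝ) : EReal) * P.dual φ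
        ≤ P.dual (t • ψ + (1 - t) • φ)) := by
  obtain ⟨T, p₀, hT, hfl⟩ := hfeas
  obtain ⟨k, hk⟩ := EReal.exists_nnreal_neg_le hc_bdd
  have hcm : ∀ i, Measurable fun x => P.cost (x, i) := fun i =>
    (hc.comp (Continuous.prodMk_left i)).measurable
  have hcm' : Measurable P.cost := measurable_from_prod_countable_left hcm
  have hTm : ∀ i, MeasurableSet (T ⁻¹' {i}) := fun i => hT (measurableSet_singleton i)
  have hTval : ∀ i, P.μ.map T {i} = P.μ (T ⁻¹' {i}) := fun i =>
    Measure.map_apply hT (measurableSet_singleton i)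
  let ρ₀ : MeasureSplitting P.stations P.μ := .ofMap hTm
  have hρ₀ : ∀ i, ρ₀.1 i univ = P.μ.map T {i} := fun i => by
    rw [hTval]
    exact Measure.restrict_apply_univ _
  have hfin : IsFiniteMeasure P.μ := by
    refine ⟨?_⟩
    rw [← ρ₀.sum_apply univ]
    exact ENNReal.sum_lt_top.2 fun i _ => by
      rw [hρ₀]
      exact (hfl.load_ne_top i).lt_top
  have hfeas₀ := (P.flowFeasible_iff ρ₀ p₀).1 (by simpa only [hρ₀] using hfl)
  have hle : ∀ e, P.lo e ≤ P.hi e := fun e => (hfl.limits e).1.trans (hfl.limits e).2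
  have hval := P.kantorovichValue_eq hcm' hk
  obtain ⟨ρ, p, hρp, hmin⟩ :=
    P.exists_isMin_totalCost hcm hk harc_ne_bot harc_lsc ⟨ρ₀, p₀, hfeas₀⟩
  have hval' : P.kantorovichValue = P.totalCost ρ p := by
    rw [hval]
    exact le_antisymm (iInf₂_le_of_le ρ p (iInf_le _ hρp))
      (le_iInf fun σ => le_iInf fun q => le_iInf fun h => hmin σ q h)
  have hweak : ∀ ψ : N → ℝ, P.dual ψ ≤ P.kantorovichValue := fun ψ => by
    have := P.dual_le hcm hk ψ ρ hρp.2
    rw [hval']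
    simpa [hρp.1] using this
  refine ⟨le_antisymm ?_ (iSup_le hweak), ⟨P.plan ρ, p, (P.kantorovichFeasible_plan_iff ρ p).2 hρp,
    by rw [P.kantorovichCost_plan hcm' hk, hval']⟩,
    fun ψ e => P.exists_isMinOn_reducedArcCost harc_ne_bot harc_lsc ψ e (hle e), fun ψ => ?_,
    fun hne ψ => ((hweak ψ).trans_lt hne.lt_top).ne,
    fun ψ φ t h0 h1 => P.dual_concave hcm hk harc_ne_bot harc_lsc hle T ψ φ h0 h1⟩
  -- It suffices to treat real `α` below the value. As the minimum is attained, `(supply, α)` then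
  -- lies outside the epigraph.
  · refine EReal.ge_of_forall_gt_iff_ge.1 fun α hα => ?_
    have hα' : (P.supply, α) ∉ P.valueEpigraph := by
      rintro ⟨σ, q, hq, hs, hC⟩
      rw [hval'] at hα
      exact absurd ((hmin σ q ⟨hs, hq⟩).trans hC) (not_le.2 hα)
    obtain ⟨ψ, hψ⟩ := P.exists_le_dual hcm hk harc_ne_bot harc_convex harc_lsc hle T hα'
    exact hψ.trans (le_iSup P.dual ψ)
  · obtain ⟨σ, q, hq, heq⟩ := P.exists_dual_eq hcm hk harc_ne_bot harc_lsc hle T ψ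
    rw [heq]
    exact fun h => (EReal.add_eq_bot_iff.1 h).elim
      (P.totalCost_ne_bot hcm hk harc_ne_bot σ q) (EReal.coe_ne_bot _)
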